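/- All graphs are finite and simple. A hole of a graph $G$ is an induced cycle of $G$ of length at least $4$; it is odd if its length is odd. For $l\ge 2$, let $\mathcal G_l$ be the family of graphs that have girth $2l+1$ and have no odd hole of length at least $2l+3$. A graph $G$ is $4$-vertex-critical if $\chi(G)=4$ and $\chi(G-v)<4$ for every vertex $v$. For $S,X\subseteq V(G)$ and a vertex $x$, $N_S(x)$ is the set of neighbours of $x$ in $S$, and $N_S(X)$ is the set of vertices of $S\setminus X$ with a neighbour in $X$. For a subgraph $H$ of $G$ we write $N_H$ for $N_{V(H)}$. For a path $P$, $P^*$ denotes the set of its internal vertices. A $K_4$-subdivision in $G$, written $H=(u_1,u_2,u_3,u_4,P_1,P_2,Q_1,Q_2,L_1,L_2)$, is a subgraph of $G$ consisting of four distinct vertices $u_1,\dots,u_4$ and six paths of $G$ that pairwise share no vertices other than common ends, where $P_1$ is a $(u_1,u_2)$-path, $P_2$ a $(u_3,u_4)$-path, $Q_1$ a $(u_2,u_3)$-path, $Q_2$ a $(u_1,u_4)$-path, $L_1$ a $(u_1,u_3)$-path and $L_2$ a $(u_2,u_4)$-path. It is odd if the four cycles $P_1\cup Q_1\cup L_1$,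 $P_1\cup Q_2\cup L_2$, $P_2\cup Q_1\cup L_2$ and $P_2\cup Q_2\cup L_1$ are odd holes of $G$. Let $A,B\subseteq V(G)$ be disjoint. An induced $(v_1,v_2)$-path $P$ of $G$ with no vertex in $A\cup B$ is a direct connection linking $A$ and $B$ if $v_1$ is the only vertex of $P$ with a neighbour in $A$ and $v_2$ is the only vertex of $P$ with a neighbour in $B$ (possibly $v_1=v_2$). It is minimal if no direct connection linking $A$ and $B$ has a vertex set properly contained in $V(P)$. **Lemma.** Let $l\ge 4$ be an integer and let $G\in\mathcal G_l$ be $4$-vertex-critical. Then either $G$ has no odd $K_4$-subdivision, or $G$ has an odd $K_4$-subdivision $H=(u_1,u_2,u_3,u_4,P_1,P_2,Q_1,Q_2,L_1,L_2)$ such that every minimal direct connection linking $V(H)\setminus P_2^*$ and $P_2^*$, with ends $v_1,v_2$ as above, satisfies $$N_H(v_1)=N_{V(H)\setminus P_2^*}(v_1)\in\bigl\{\{u_3\},\{u_4\}\bigr\}\quad\text{and}\quad N_H(v_2)=N_{P_2^*}(v_2)=N_{P_2^*}\bigl(N_H(v_1)\bigr).$$ -/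

import Mathlib

namespace OddK4

variable {V : Type*}

/-- A walk is chordless if any two adjacent vertices on it are joined by an edge of the walk. For a
path (a cycle) this says that its vertex set induces just this path (this cycle) in `G`. -/
def Chordless (G : SimpleGraph V) {a b : V} (p : G.Walk a b) : Prop :=
  ∀ x ∈ p.support, ∀ y ∈ p.support, G.Adj x y → s(x, y) ∈ p.edges

/-- A hole of `G`: an induced cycle of `G` of length at least `4`. -/
structure IsHole (G : SimpleGraph V) {a : V} (c : G.Walk a a) : Prop where
  isCycle : c.IsCycle
  four_le : 4 ≤ c.length
  chordless : Chordless G c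

/-- A hole of odd length. -/
def IsOddHole (G : SimpleGraph V) {a : V} (c : G.Walk a a) : Prop :=
  IsHole G c ∧ Odd c.length

/-- The family of graphs of girth `2l+1` with no odd hole of length at least `2l+3`. -/
structure InFamily (l : ℕ) (G : SimpleGraph V) : Prop where
  girth_eq : G.girth = 2 * l + 1
  no_long_odd_hole : ∀ (a : V) (c : G.Walk a a), IsOddHole G c → ¬ 2 * l + 3 ≤ c.length

/-- `G` has chromatic number `k`, and deleting any vertex lowers the chromatic number. -/
structure IsVertexCritical (k : ℕ) (G : SimpleGraph V) : Prop where
  chromaticNumber_eq : G.chromaticNumber = k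
  delete_lt : ∀ v : V, (G.induce ({v}ᶜ : Set V)).chromaticNumber < k

/-- `N_S(x)`: the neighbours of `x` in `S`. -/
def nbrs (G : SimpleGraph V) (S : Set V) (x : V) : Set V :=
  {y | y ∈ S ∧ G.Adj x y}

/-- `N_S(X)`: the vertices of `S` outside `X` with a neighbour in `X`. -/
def nbrsOfSet (G : SimpleGraph V) (S X : Set V) : Set V :=
  {y | y ∈ S ∧ y ∉ X ∧ ∃ x ∈ X, G.Adj x y}

/-- `P^*`: the set of internal vertices of an `(a, b)`-path `P`. -/
def innerVerts {G : SimpleGraph V} {a b : V} (p : G.Walk a b) : Set V :=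
  {x | x ∈ p.support ∧ x ≠ a ∧ x ≠ b}

/-- A subdivision `(u₁,u₂,u₃,u₄,P₁,P₂,Q₁,Q₂,L₁,L₂)` of `K₄` that is a subgraph of `G`: four distinct
vertices, any two of them joined by a path (an arris), and these six paths share no vertices other
than common ends. -/
structure K4Subdivision (G : SimpleGraph V) where
  u₁ : V
  u₂ : V
  u₃ : V
  u₄ : V
  P₁ : G.Walk u₁ u₂
  P₂ : G.Walk u₃ u₄
  Q₁ : G.Walk u₂ u₃
  Q₂ : G.Walk u₁ u₄
  L₁ : G.Walk u₁ u₃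
  L₂ : G.Walk u₂ u₄
  isPath_P₁ : P₁.IsPath
  isPath_P₂ : P₂.IsPath
  isPath_Q₁ : Q₁.IsPath
  isPath_Q₂ : Q₂.IsPath
  isPath_L₁ : L₁.IsPath
  isPath_L₂ : L₂.IsPath
  distinct : [u₁, u₂, u₃, u₄].Nodup
  branch_notMem : ∀ u ∈ [u₁, u₂, u₃, u₄],
    ∀ I ∈ [innerVerts P₁, innerVerts P₂, innerVerts Q₁, innerVerts Q₂, innerVerts L₁, innerVerts L₂], u ∉ I
  disjoint_innerVerts :
    [innerVerts P₁, innerVerts P₂, innerVerts Q₁, innerVerts Q₂, innerVerts L₁, innerVerts L₂].Pairwise Disjoint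

namespace K4Subdivision

variable {G : SimpleGraph V} (H : K4Subdivision G)

/-- The vertex set of the subdivision. -/
def verts : Set V :=
  {x | x ∈ H.P₁.support ∨ x ∈ H.P₂.support ∨ x ∈ H.Q₁.support ∨ x ∈ H.Q₂.support ∨
    x ∈ H.L₁.support ∨ x ∈ H.L₂.support}

/-- The face cycle `P₁ ∪ Q₁ ∪ L₁`. -/
def C₁ : G.Walk H.u₁ H.u₁ := (H.P₁.append H.Q₁).append H.L₁.reverse

/-- The face cycle `P₁ ∪ Q₂ ∪ L₂`. -/
def C₂ : G.Walk H.u₁ H.u₁ := (H.P₁.append H.L₂).append H.Q₂.reverse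

/-- The face cycle `P₂ ∪ Q₁ ∪ L₂`. -/
def C₃ : G.Walk H.u₂ H.u₂ := (H.Q₁.append H.P₂).append H.L₂.reverse

/-- The face cycle `P₂ ∪ Q₂ ∪ L₁`; its edges are those that lie on an odd number of the other
three face cycles. -/
def C₄ : G.Walk H.u₁ H.u₁ := (H.L₁.append H.P₂).append H.Q₂.reverse

/-- The four face cycles are odd holes of `G`. -/
structure IsOdd : Prop where
  oddHole_C₁ : IsOddHole G H.C₁
  oddHole_C₂ : IsOddHole G H.C₂
  oddHole_C₃ : IsOddHole G H.C₃
  oddHole_C₄ : IsOddHole G H.C₄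

end K4Subdivision

/-- An induced `(v₁, v₂)`-path `p` of `G`, vertex disjoint from `A` and `B`, is a direct connection
linking (the subgraphs induced by) `A` and `B` if `v₁` is its only vertex with a neighbour in `A`
and `v₂` is its only vertex with a neighbour in `B`. -/
structure IsDirectConnection (G : SimpleGraph V) (A B : Set V) {v₁ v₂ : V} (p : G.Walk v₁ v₂) :
    Prop where
  isPath : p.IsPath
  chordless : Chordless G p
  notMem_left : ∀ x ∈ p.support, x ∉ A
  notMem_right : ∀ x ∈ p.support, x ∉ B
  left_iff : ∀ x ∈ p.support, (∃ a ∈ A, G.Adj x a) ↔ x = v₁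
  right_iff : ∀ x ∈ p.support, (∃ b ∈ B, G.Adj x b) ↔ x = v₂

/-- A direct connection whose vertex set does not properly contain that of another one. -/
structure IsMinimalDirectConnection (G : SimpleGraph V) (A B : Set V) {v₁ v₂ : V}
    (p : G.Walk v₁ v₂) : Prop where
  isDirectConnection : IsDirectConnection G A B p
  minimal : ∀ (w₁ w₂ : V) (q : G.Walk w₁ w₂), IsDirectConnection G A B q →
    q.support ⊆ p.support → p.support ⊆ q.support

end OddK4

namespace OddK4

open SimpleGraph

variable {V : Type*} {G : SimpleGraph V}

/-! Choose an odd $K_4$-subdivision $H$ with $P_2$ as short as possible.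

Girth $2l+1$ and the ban on longer odd holes force every odd hole to have length exactly $2l+1$.
Applied to the four faces, this makes opposite arrises equally long, with $|P_1|+|Q_1|+|L_1|=2l+1$,
and each arris has length at most $l$. For $l\ge 4$ any two vertices of $H$ are then within distance
$2l-2$ inside $H$ (`IsOdd.near`). By the girth, $H$ is induced and a vertex outside $H$ has at most
one neighbour in $H$ (`IsOdd.edge_mem`, `IsOdd.eq_of_adj`).

A direct connection therefore extends to an ear $R$ of $H$ from some $x\notin P_2^*$ to some $y\in
P_2^*$. An induced $(x,y)$-path of $H$ closes up with $R$ to a cycle of length at least $2l+1$, with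
equality if the length is odd. If $x$ lies on one of $Q_1,Q_2,L_1,L_2$, comparing several such paths
leaves only $x\in\{u_3,u_4\}$ with $x$ adjacent to $y$ (`IsOdd.ear_L₁`). If $x\in P_1^*$, replacing
$Q_1$ or $L_1$ by $R$ gives an odd $K_4$-subdivision with a shorter $P_2$, contrary to the choice of
$H$ (`IsOdd.not_ear_P₁`). -/

/-! ### Gluing paths and closed walks. -/

theorem isPath_append {u v w : V} {p : G.Walk u v} {q : G.Walk v w} (hp : p.IsPath)
    (hq : q.IsPath) (h : ∀ z ∈ p.support, z ∈ q.support → z = v) : (p.append q).IsPath := by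
  rw [Walk.isPath_def, Walk.support_append, List.nodup_append]
  refine ⟨hp.support_nodup, hq.support_nodup.tail, ?_⟩
  rintro a ha b hb rfl
  have h1 := h a ha (List.mem_of_mem_tail hb)
  subst h1
  have := hq.support_nodup
  rw [← Walk.cons_tail_support] at this
  exact (List.nodup_cons.1 this).1 hb

theorem length_eq_one_of_edge {u v : V} {p : G.Walk u v} (hp : p.IsPath)
    (h : s(u, v) ∈ p.edges) : p.length = 1 := by
  cases p with
  | nil => simp at h
  | cons hadj q =>
    rw [Walk.cons_isPath_iff] at hp
    rw [Walk.edges_cons, List.mem_cons] at h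
    rcases h with h | h
    · have : q.length = 0 := by
        rcases Sym2.eq_iff.1 h with ⟨_, rfl⟩ | ⟨rfl, rfl⟩
        · simpa using hp.1
        · exact absurd q.end_mem_support hp.2
      simp [this]
    · exact absurd (q.fst_mem_support_of_mem_edges h) hp.2

theorem isCycle_append {u v : V} {p : G.Walk u v} {q : G.Walk v u} (hp : p.IsPath)
    (hq : q.IsPath) (huv : u ≠ v) (hlen : 3 ≤ p.length + q.length)
    (h : ∀ z ∈ p.support, z ∈ q.support → z = u ∨ z = v) : (p.append q).IsCycle := by
  cases p with
  | nil => exact absurd rfl huv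
  | @cons _ w _ hadj p' =>
    have hp' := (Walk.cons_isPath_iff _ _).1 hp
    rw [Walk.cons_append, Walk.cons_isCycle_iff]
    refine ⟨isPath_append hp'.1 hq fun z hz hzq => ?_, ?_⟩
    · rcases h z (by simp [hz]) hzq with rfl | h
      · exact absurd hz hp'.2
      · exact h
    · rw [Walk.edges_append, List.mem_append]
      rintro (he | he)
      · exact hp'.2 (p'.fst_mem_support_of_mem_edges he)
      · have hw := q.snd_mem_support_of_mem_edges he
        rcases h w (by simp) hw with rfl | rfl
        · exact hadj.ne rfl
        · have h1 := length_eq_one_of_edge hq (by rwa [Sym2.eq_swap])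
          have h2 : p'.length = 0 := by simpa using hp'.1
          -- Both paths would be the single edge $uv$, which the bound 3 on the total length
          -- excludes.
          simp [h1, h2] at hlen

theorem isCycle_append_comm {u v : V} {p : G.Walk u v} {q : G.Walk v u}
    (h : (p.append q).IsCycle) : (q.append p).IsCycle := by
  rw [Walk.isCycle_def] at h ⊢
  obtain ⟨h1, h2, h3⟩ := h
  refine ⟨?_, ?_, ?_⟩
  · rw [Walk.isTrail_def, Walk.edges_append] at h1 ⊢
    exact List.perm_append_comm.nodup_iff.1 h1
  · intro h
    apply h2
    have := congrArg Walk.length h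
    rw [Walk.length_append, Walk.length_nil] at this
    exact Walk.eq_nil_iff_nil.2 (Walk.length_eq_zero_iff.1 (by rw [Walk.length_append]; omega))
  · rw [Walk.tail_support_append] at h3 ⊢
    exact List.perm_append_comm.nodup_iff.1 h3

theorem IsOddHole.append_comm {u v : V} {p : G.Walk u v} {q : G.Walk v u}
    (h : IsOddHole G (p.append q)) : IsOddHole G (q.append p) := by
  obtain ⟨⟨h1, h2, h3⟩, h4⟩ := h
  refine ⟨⟨isCycle_append_comm h1, ?_, ?_⟩, ?_⟩
  · simp at h2 ⊢; omega
  · intro x hx y hy hxy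
    have := h3 x (by simp only [Walk.mem_support_append_iff] at hx ⊢; tauto) y
      (by simp only [Walk.mem_support_append_iff] at hy ⊢; tauto) hxy
    simp only [Walk.edges_append, List.mem_append] at this ⊢
    tauto
  · simpa [add_comm] using h4

theorem IsOddHole.reverse {u : V} {p : G.Walk u u} (h : IsOddHole G p) :
    IsOddHole G p.reverse := by
  obtain ⟨⟨h1, h2, h3⟩, h4⟩ := h
  refine ⟨⟨h1.reverse, by simpa using h2, ?_⟩, by simpa using h4⟩
  intro x hx y hy hxy
  simpa using h3 x (by simpa using hx) y (by simpa using hy) hxy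

theorem innerVerts_reverse {a b : V} (p : G.Walk a b) : innerVerts p.reverse = innerVerts p := by
  ext x
  simp [innerVerts, and_comm]

/-- The closed walk splits into two arcs between $z$ and $w$; the shorter one serves. -/
theorem exists_walk_of_mem_closed {a z w : V} (c : G.Walk a a) (hz : z ∈ c.support)
    (hw : w ∈ c.support) :
    ∃ W : G.Walk z w, 2 * W.length ≤ c.length ∧ W.edges ⊆ c.edges ∧ W.support ⊆ c.support := by
  obtain ⟨p, q, rfl⟩ := Walk.mem_support_iff_exists_append.1 hz
  have hw' : w ∈ (q.append p).support := by
    simp only [Walk.mem_support_append_iff] at hw ⊢; tauto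
  obtain ⟨r, s, hrs⟩ := Walk.mem_support_iff_exists_append.1 hw'
  have hl := congrArg Walk.length hrs
  have he : ∀ e, e ∈ (q.append p).edges ↔ e ∈ (r.append s).edges := by rw [hrs]; simp
  have hv : ∀ e, e ∈ (q.append p).support ↔ e ∈ (r.append s).support := by rw [hrs]; simp
  simp only [Walk.length_append, Walk.edges_append, List.mem_append,
    Walk.mem_support_append_iff] at hl he hv
  by_cases h : r.length ≤ s.length
  · refine ⟨r, by simp; omega, fun e h => ?_, fun e h => ?_⟩
    · have := he e; simp; tauto
    · have := hv e; simp only [Walk.mem_support_append_iff]; tauto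
  · refine ⟨s.reverse, by simp; omega, fun e h => ?_, fun e h => ?_⟩
    · have := he e; simp at h ⊢; tauto
    · have := hv e; simp only [Walk.mem_support_append_iff, Walk.support_reverse, List.mem_reverse] at h ⊢; tauto

theorem InFamily.le_length_of_isCycle {l : ℕ} (hG : InFamily l G) {a : V} {c : G.Walk a a}
    (hc : c.IsCycle) : 2 * l + 1 ≤ c.length :=
  hG.girth_eq ▸ girth_le_length hc

theorem InFamily.length_of_isOddHole {l : ℕ} (hG : InFamily l G) {a : V} {c : G.Walk a a}
    (hc : IsOddHole G c) : c.length = 2 * l + 1 := by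
  have h1 := hG.le_length_of_isCycle hc.1.isCycle
  have h2 := hG.no_long_odd_hole a c hc
  obtain ⟨k, hk⟩ := hc.2
  omega

theorem isPath_eq_of_edge_start {a b w y : V} {p : G.Walk a b} (hp : p.IsPath)
    (hw : s(a, w) ∈ p.edges) (hy : s(a, y) ∈ p.edges) : w = y := by
  cases p with
  | nil => simp at hw
  | @cons _ c _ hadj q =>
    have ha := ((Walk.cons_isPath_iff _ _).1 hp).2
    have key : ∀ z, s(a, z) ∈ (Walk.cons hadj q).edges → z = c := fun z hz => by
      rw [Walk.edges_cons, List.mem_cons] at hz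
      rcases hz with hz | hz
      · exact Sym2.congr_right.1 hz
      · exact absurd (q.fst_mem_support_of_mem_edges hz) ha
    rw [key w hw, key y hy]

/-! ### Symmetries of a subdivision: the two swaps carry each of $Q_1,Q_2,L_2$ to the place of
$L_1$, while `cyc` and its square bring $Q_2$ and $L_2$ to the place of $P_2$. -/

namespace K4Subdivision

variable (H : K4Subdivision G)

/-- Interchange `u₁` and `u₂`. -/
def swapLeft : K4Subdivision G where
  u₁ := H.u₂
  u₂ := H.u₁
  u₃ := H.u₃
  u₄ := H.u₄
  P₁ := H.P₁.reverse
  P₂ := H.P₂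
  Q₁ := H.L₁
  Q₂ := H.L₂
  L₁ := H.Q₁
  L₂ := H.Q₂
  isPath_P₁ := H.isPath_P₁.reverse
  isPath_P₂ := H.isPath_P₂
  isPath_Q₁ := H.isPath_L₁
  isPath_Q₂ := H.isPath_L₂
  isPath_L₁ := H.isPath_Q₁
  isPath_L₂ := H.isPath_Q₂
  distinct := by have := H.distinct; simp at this ⊢; grind
  branch_notMem := by
    have := H.branch_notMem
    simp only [List.mem_cons, List.not_mem_nil, or_false, forall_eq_or_imp, forall_eq, innerVerts_reverse] at this ⊢
    tauto
  disjoint_innerVerts := by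
    have := H.disjoint_innerVerts
    simp only [List.pairwise_cons, List.mem_cons, List.not_mem_nil, or_false, forall_eq_or_imp, forall_eq, innerVerts_reverse] at this ⊢
    simp_all [disjoint_comm]

/-- Interchange `u₃` and `u₄`. -/
def swapRight : K4Subdivision G where
  u₁ := H.u₁
  u₂ := H.u₂
  u₃ := H.u₄
  u₄ := H.u₃
  P₁ := H.P₁
  P₂ := H.P₂.reverse
  Q₁ := H.L₂
  Q₂ := H.L₁
  L₁ := H.Q₂
  L₂ := H.Q₁
  isPath_P₁ := H.isPath_P₁
  isPath_P₂ := H.isPath_P₂.reverse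
  isPath_Q₁ := H.isPath_L₂
  isPath_Q₂ := H.isPath_L₁
  isPath_L₁ := H.isPath_Q₂
  isPath_L₂ := H.isPath_Q₁
  distinct := by have := H.distinct; simp at this ⊢; grind
  branch_notMem := by
    have := H.branch_notMem
    simp only [List.mem_cons, List.not_mem_nil, or_false, forall_eq_or_imp, forall_eq, innerVerts_reverse] at this ⊢
    tauto
  disjoint_innerVerts := by
    have := H.disjoint_innerVerts
    simp only [List.pairwise_cons, List.mem_cons, List.not_mem_nil, or_false, forall_eq_or_imp, forall_eq, innerVerts_reverse] at this ⊢
    simp_all [disjoint_comm]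

/-- Permute `u₁`, `u₂`, `u₃` cyclically. -/
def cyc : K4Subdivision G where
  u₁ := H.u₂
  u₂ := H.u₃
  u₃ := H.u₁
  u₄ := H.u₄
  P₁ := H.Q₁
  P₂ := H.Q₂
  Q₁ := H.L₁.reverse
  Q₂ := H.L₂
  L₁ := H.P₁.reverse
  L₂ := H.P₂
  isPath_P₁ := H.isPath_Q₁
  isPath_P₂ := H.isPath_Q₂
  isPath_Q₁ := H.isPath_L₁.reverse
  isPath_Q₂ := H.isPath_L₂
  isPath_L₁ := H.isPath_P₁.reverse
  isPath_L₂ := H.isPath_P₂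
  distinct := by have := H.distinct; simp at this ⊢; grind
  branch_notMem := by
    have := H.branch_notMem
    simp only [List.mem_cons, List.not_mem_nil, or_false, forall_eq_or_imp, forall_eq, innerVerts_reverse] at this ⊢
    tauto
  disjoint_innerVerts := by
    have := H.disjoint_innerVerts
    simp only [List.pairwise_cons, List.mem_cons, List.not_mem_nil, or_false, forall_eq_or_imp, forall_eq, innerVerts_reverse] at this ⊢
    simp_all [disjoint_comm]

variable {H}

theorem IsOdd.swapLeft (h : H.IsOdd) : H.swapLeft.IsOdd where
  oddHole_C₁ := by
    have := h.oddHole_C₁.reverse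
    simp only [C₁, Walk.reverse_append, Walk.reverse_reverse] at this
    rw [Walk.append_assoc] at this
    simpa [C₁, K4Subdivision.swapLeft, Walk.append_assoc] using this.append_comm
  oddHole_C₂ := by
    have := h.oddHole_C₂.reverse
    simp only [C₂, Walk.reverse_append, Walk.reverse_reverse] at this
    rw [Walk.append_assoc] at this
    simpa [C₂, K4Subdivision.swapLeft, Walk.append_assoc] using this.append_comm
  oddHole_C₃ := h.oddHole_C₄
  oddHole_C₄ := h.oddHole_C₃

theorem IsOdd.swapRight (h : H.IsOdd) : H.swapRight.IsOdd where
  oddHole_C₁ := h.oddHole_C₂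
  oddHole_C₂ := h.oddHole_C₁
  oddHole_C₃ := by
    have := h.oddHole_C₃.reverse
    simp only [C₃, Walk.reverse_append, Walk.reverse_reverse] at this
    simpa [C₃, K4Subdivision.swapRight, Walk.append_assoc] using this
  oddHole_C₄ := by
    have := h.oddHole_C₄.reverse
    simp only [C₄, Walk.reverse_append, Walk.reverse_reverse] at this
    simpa [C₄, K4Subdivision.swapRight, Walk.append_assoc] using this

theorem IsOdd.cyc (h : H.IsOdd) : H.cyc.IsOdd where
  oddHole_C₁ := by
    have := h.oddHole_C₁
    rw [C₁, ← Walk.append_assoc] at this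
    simpa [C₁, K4Subdivision.cyc, Walk.append_assoc] using this.append_comm
  oddHole_C₂ := h.oddHole_C₃
  oddHole_C₃ := by
    have := h.oddHole_C₄.reverse
    simp only [C₄, Walk.reverse_append, Walk.reverse_reverse] at this
    rw [Walk.append_assoc] at this
    simpa [C₃, K4Subdivision.cyc, Walk.append_assoc] using this.append_comm
  oddHole_C₄ := by
    have := h.oddHole_C₂.reverse
    simp only [C₂, Walk.reverse_append, Walk.reverse_reverse] at this
    rw [Walk.append_assoc] at this
    simpa [C₄, K4Subdivision.cyc, Walk.append_assoc] using this.append_comm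

end K4Subdivision

theorem eq_or_eq_or_mem_innerVerts {a b z : V} {p : G.Walk a b} (hz : z ∈ p.support) :
    z = a ∨ z = b ∨ z ∈ innerVerts p := by
  by_cases h1 : z = a
  · exact .inl h1
  by_cases h2 : z = b
  · exact .inr (.inl h2)
  exact .inr (.inr ⟨hz, h1, h2⟩)

/-! ### Arris lengths and distances in an odd subdivision. -/

namespace K4Subdivision

variable (H : K4Subdivision G)

/-- The edge set of the subdivision. -/
def edges : Set (Sym2 V) :=
  {e | e ∈ H.P₁.edges ∨ e ∈ H.P₂.edges ∨ e ∈ H.Q₁.edges ∨ e ∈ H.Q₂.edges ∨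
    e ∈ H.L₁.edges ∨ e ∈ H.L₂.edges}

theorem verts_swapLeft : H.swapLeft.verts = H.verts := by
  ext z; simp [verts, swapLeft]; tauto

theorem verts_swapRight : H.swapRight.verts = H.verts := by
  ext z; simp [verts, swapRight]; tauto

theorem verts_cyc : H.cyc.verts = H.verts := by
  ext z; simp [verts, cyc]; tauto

theorem edges_cyc : H.cyc.edges = H.edges := by
  ext z; simp [edges, cyc]; tauto

theorem arris_inter :
    (∀ z ∈ H.P₁.support, z ∉ H.P₂.support) ∧
    (∀ z ∈ H.Q₁.support, z ∉ H.Q₂.support) ∧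
    (∀ z ∈ H.L₁.support, z ∉ H.L₂.support) ∧
    (∀ z ∈ H.P₁.support, z ∈ H.Q₁.support → z = H.u₂) ∧
    (∀ z ∈ H.P₁.support, z ∈ H.Q₂.support → z = H.u₁) ∧
    (∀ z ∈ H.P₁.support, z ∈ H.L₁.support → z = H.u₁) ∧
    (∀ z ∈ H.P₁.support, z ∈ H.L₂.support → z = H.u₂) ∧
    (∀ z ∈ H.P₂.support, z ∈ H.Q₁.support → z = H.u₃) ∧
    (∀ z ∈ H.P₂.support, z ∈ H.Q₂.support → z = H.u₄) ∧
    (∀ z ∈ H.P₂.support, z ∈ H.L₁.support → z = H.u₃) ∧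
    (∀ z ∈ H.P₂.support, z ∈ H.L₂.support → z = H.u₄) ∧
    (∀ z ∈ H.Q₁.support, z ∈ H.L₁.support → z = H.u₃) ∧
    (∀ z ∈ H.Q₁.support, z ∈ H.L₂.support → z = H.u₂) ∧
    (∀ z ∈ H.Q₂.support, z ∈ H.L₁.support → z = H.u₁) ∧
    (∀ z ∈ H.Q₂.support, z ∈ H.L₂.support → z = H.u₄) := by
  have h1 := H.distinct
  have h2 := H.branch_notMem
  have h3 := H.disjoint_innerVerts
  simp only [List.mem_cons, List.not_mem_nil, or_false, forall_eq_or_imp, forall_eq,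
    List.pairwise_cons, List.nodup_cons, not_or, Set.disjoint_left] at h1 h2 h3
  refine ⟨?_, ?_, ?_, ?_, ?_, ?_, ?_, ?_, ?_, ?_, ?_, ?_, ?_, ?_, ?_⟩ <;>
  · intro z hz
    try intro hw
    rcases eq_or_eq_or_mem_innerVerts hz with hz | hz | hz <;>
    rcases eq_or_eq_or_mem_innerVerts hw with hw | hw | hw <;> grind

variable {H}

/-- All four faces have length $2l+1$, and every arris lies on exactly two of them; the linear
equations give the rest. -/
theorem IsOdd.lengths {l : ℕ} (hG : InFamily l G) (hH : H.IsOdd) :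
    H.P₂.length = H.P₁.length ∧ H.Q₂.length = H.Q₁.length ∧ H.L₂.length = H.L₁.length ∧
      H.P₁.length + H.Q₁.length + H.L₁.length = 2 * l + 1 := by
  have h1 := hG.length_of_isOddHole hH.oddHole_C₁
  have h2 := hG.length_of_isOddHole hH.oddHole_C₂
  have h3 := hG.length_of_isOddHole hH.oddHole_C₃
  have h4 := hG.length_of_isOddHole hH.oddHole_C₄
  simp only [C₁, C₂, C₃, C₄, Walk.length_append, Walk.length_reverse] at h1 h2 h3 h4
  omega

variable (H) in
theorem branch_ne : H.u₁ ≠ H.u₂ ∧ H.u₁ ≠ H.u₃ ∧ H.u₁ ≠ H.u₄ ∧ H.u₂ ≠ H.u₃ ∧ H.u₂ ≠ H.u₄ ∧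
    H.u₃ ≠ H.u₄ := by
  have h1 := H.distinct
  simp only [List.nodup_cons, List.mem_cons, List.not_mem_nil, or_false, not_or] at h1
  tauto

/-- The cycle $P_1\cup Q_1\cup P_2\cup Q_2$ has length $2(|P_1|+|Q_1|)\ge 2l+1$, so $|P_1|+|Q_1|\ge
l+1$. -/
theorem IsOdd.length_L₁_le {l : ℕ} (hG : InFamily l G) (hH : H.IsOdd) : H.L₁.length ≤ l := by
  obtain ⟨h1, h2, h3, h4⟩ := hH.lengths hG
  obtain ⟨i1, i2, i3, i4, i5, i6, i7, i8, i9, i10, i11, i12, i13, i14, i15⟩ := H.arris_inter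
  obtain ⟨n1, n2, n3, n4, n5, n6⟩ := H.branch_ne
  have e1 : H.P₁.length ≠ 0 := fun h => n1 (Walk.eq_of_length_eq_zero h)
  have e2 : H.Q₁.length ≠ 0 := fun h => n4 (Walk.eq_of_length_eq_zero h)
  have c : ((H.P₁.append H.Q₁).append (H.P₂.append H.Q₂.reverse)).IsCycle := by
    apply isCycle_append
    · exact isPath_append H.isPath_P₁ H.isPath_Q₁ i4
    · exact isPath_append H.isPath_P₂ H.isPath_Q₂.reverse (by simpa using i9)
    · exact n2
    · simp only [Walk.length_append, Walk.length_reverse]; omega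
    · intro z
      simp only [Walk.mem_support_append_iff, Walk.support_reverse, List.mem_reverse]
      grind
  have := hG.le_length_of_isCycle c
  simp only [Walk.length_append, Walk.length_reverse] at this
  omega

theorem IsOdd.lengths_le {l : ℕ} (hG : InFamily l G) (hH : H.IsOdd) :
    H.P₁.length ≤ l ∧ H.Q₁.length ≤ l ∧ H.L₁.length ≤ l := by
  refine ⟨?_, ?_, hH.length_L₁_le hG⟩
  · simpa [K4Subdivision.cyc] using hH.cyc.length_L₁_le hG
  · simpa [K4Subdivision.cyc] using hH.cyc.cyc.length_L₁_le hG

/-- Two vertices are joined by a walk of length at most `n` in the subdivision. -/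
def Near (H : K4Subdivision G) (n : ℕ) (z w : V) : Prop :=
  ∃ W : G.Walk z w, W.length ≤ n ∧ (∀ e ∈ W.edges, e ∈ H.edges) ∧ ∀ v ∈ W.support, v ∈ H.verts

theorem near_of_closed {l : ℕ} (hl : 4 ≤ l) {a z w : V} {c : G.Walk a a}
    (hlen : c.length = 2 * l + 1) (he : ∀ e ∈ c.edges, e ∈ H.edges)
    (hv : ∀ v ∈ c.support, v ∈ H.verts) (hz : z ∈ c.support) (hw : w ∈ c.support) :
    H.Near (2 * l - 2) z w := by
  obtain ⟨W, h1, h2, h3⟩ := exists_walk_of_mem_closed c hz hw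
  exact ⟨W, by omega, fun e h => he e (h2 h), fun e h => hv e (h3 h)⟩

theorem IsOdd.near_opposite {l : ℕ} (hl : 4 ≤ l) (hG : InFamily l G) (hH : H.IsOdd) {z w : V}
    (hz : z ∈ H.P₁.support) (hw : w ∈ H.P₂.support) : H.Near (2 * l - 2) z w := by
  obtain ⟨h1, h2, h3, h4⟩ := hH.lengths hG
  obtain ⟨h5, h6, h7⟩ := hH.lengths_le hG
  obtain ⟨A, A', hA⟩ := Walk.mem_support_iff_exists_append.1 hz
  obtain ⟨B, B', hB⟩ := Walk.mem_support_iff_exists_append.1 hw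
  have hAl := congrArg Walk.length hA
  have hBl := congrArg Walk.length hB
  rw [Walk.length_append] at hAl hBl
  -- The four walks along $L_1,Q_2,Q_1,L_2$ have total length $2(2l+1)+2|P_1|\le 6l+2$. Were each at
  -- least $2l-1$, the total would be at least $8l-4$, impossible for $l\ge 4$.
  by_cases k1 : A.length + H.L₁.length + B.length ≤ 2 * l - 2
  · refine ⟨(A.reverse.append H.L₁).append B, ?_, ?_, ?_⟩
    · simpa using k1
    · simp [edges, hA, hB]; grind
    · simp only [verts, hA, hB, Walk.mem_support_append_iff, Set.mem_ofPred_eq, Walk.support_reverse, List.mem_reverse]; grind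
  by_cases k2 : A.length + H.Q₂.length + B'.length ≤ 2 * l - 2
  · refine ⟨(A.reverse.append H.Q₂).append B'.reverse, ?_, ?_, ?_⟩
    · simpa using k2
    · simp [edges, hA, hB]; grind
    · simp only [verts, hA, hB, Walk.mem_support_append_iff, Set.mem_ofPred_eq, Walk.support_reverse, List.mem_reverse]; grind
  by_cases k3 : A'.length + H.Q₁.length + B.length ≤ 2 * l - 2
  · refine ⟨(A'.append H.Q₁).append B, ?_, ?_, ?_⟩
    · simpa using k3
    · simp [edges, hA, hB]; grind
    · simp only [verts, hA, hB, Walk.mem_support_append_iff, Set.mem_ofPred_eq]; grind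
  refine ⟨(A'.append H.L₂).append B'.reverse, ?_, ?_, ?_⟩
  · simp; omega
  · simp [edges, hA, hB]; grind
  · simp only [verts, hA, hB, Walk.mem_support_append_iff, Set.mem_ofPred_eq, Walk.support_reverse, List.mem_reverse]; grind

theorem Near.of_cyc {n : ℕ} {z w : V} (h : H.cyc.Near n z w) : H.Near n z w := by
  simpa only [Near, edges_cyc, verts_cyc] using h

theorem Near.symm {n : ℕ} {z w : V} (h : H.Near n z w) : H.Near n w z := by
  obtain ⟨W, h1, h2, h3⟩ := h
  exact ⟨W.reverse, by simpa using h1, by simpa using h2, by simpa using h3⟩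

/-- Two arrises that are not opposite lie on a common face, where a shorter arc has length at most
$l$; opposite arrises are covered by `near_opposite` and its images under `cyc`. -/
theorem IsOdd.near {l : ℕ} (hl : 4 ≤ l) (hG : InFamily l G) (hH : H.IsOdd) {z w : V}
    (hz : z ∈ H.verts) (hw : w ∈ H.verts) : H.Near (2 * l - 2) z w := by
  have c1 := fun h1 h2 => near_of_closed (H := H) (z := z) (w := w) hl
    (hG.length_of_isOddHole hH.oddHole_C₁)
    (by simp [C₁, edges]; grind)
    (by simp only [C₁, verts, Walk.mem_support_append_iff, Set.mem_ofPred_eq, Walk.support_reverse, List.mem_reverse]; grind) h1 h2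
  have c2 := fun h1 h2 => near_of_closed (H := H) (z := z) (w := w) hl
    (hG.length_of_isOddHole hH.oddHole_C₂)
    (by simp [C₂, edges]; grind)
    (by simp only [C₂, verts, Walk.mem_support_append_iff, Set.mem_ofPred_eq, Walk.support_reverse, List.mem_reverse]; grind) h1 h2
  have c3 := fun h1 h2 => near_of_closed (H := H) (z := z) (w := w) hl
    (hG.length_of_isOddHole hH.oddHole_C₃)
    (by simp [C₃, edges]; grind)
    (by simp only [C₃, verts, Walk.mem_support_append_iff, Set.mem_ofPred_eq, Walk.support_reverse, List.mem_reverse]; grind) h1 h2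
  have c4 := fun h1 h2 => near_of_closed (H := H) (z := z) (w := w) hl
    (hG.length_of_isOddHole hH.oddHole_C₄)
    (by simp [C₄, edges]; grind)
    (by simp only [C₄, verts, Walk.mem_support_append_iff, Set.mem_ofPred_eq, Walk.support_reverse, List.mem_reverse]; grind) h1 h2
  have o1 := fun h1 h2 => hH.near_opposite (z := z) (w := w) hl hG h1 h2
  have o2 := fun h1 h2 => (hH.near_opposite (z := w) (w := z) hl hG h1 h2).symm
  have o3 := fun h1 h2 => (hH.cyc.near_opposite (z := z) (w := w) hl hG h1 h2).of_cyc
  have o4 := fun h1 h2 => (hH.cyc.near_opposite (z := w) (w := z) hl hG h1 h2).of_cyc.symm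
  have o5 := fun h1 h2 => (hH.cyc.cyc.near_opposite (z := z) (w := w) hl hG h1 h2).of_cyc.of_cyc
  have o6 := fun h1 h2 => (hH.cyc.cyc.near_opposite (z := w) (w := z) hl hG h1 h2).of_cyc.of_cyc.symm
  simp only [C₁, C₂, C₃, C₄, Walk.mem_support_append_iff, Walk.support_reverse,
    List.mem_reverse] at c1 c2 c3 c4
  simp only [K4Subdivision.cyc, Walk.support_reverse, List.mem_reverse] at o3 o4 o5 o6
  rcases hz with hz | hz | hz | hz | hz | hz <;> rcases hw with hw | hw | hw | hw | hw | hw <;>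
    simp only [hz, hw, true_or, or_true, forall_const] at * <;> assumption

/-- The subdivision is an induced subgraph. -/
theorem IsOdd.edge_mem {l : ℕ} (hl : 4 ≤ l) (hG : InFamily l G) (hH : H.IsOdd) {z w : V}
    (hz : z ∈ H.verts) (hw : w ∈ H.verts) (h : G.Adj z w) : s(z, w) ∈ H.edges := by
  classical
  by_contra hne
  obtain ⟨W, h1, h2, -⟩ := hH.near hl hG hw hz
  -- An edge outside $H$ would close a cycle of length at most $2l-1$.
  have hc : (Walk.cons h W.bypass).IsCycle := by
    rw [Walk.cons_isCycle_iff]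
    exact ⟨W.bypass_isPath, fun he => hne (h2 _ (W.edges_bypass_subset_edges he))⟩
  have h3 := hG.le_length_of_isCycle hc
  have h4 := W.length_bypass_le_length
  rw [Walk.length_cons] at h3
  omega

/-- Two neighbours in $H$ would give a cycle through $v$ of length at most $(2l-2)+2$, one below the
girth. -/
theorem IsOdd.eq_of_adj {l : ℕ} (hl : 4 ≤ l) (hG : InFamily l G) (hH : H.IsOdd) {v z w : V}
    (hv : v ∉ H.verts) (hz : z ∈ H.verts) (hw : w ∈ H.verts) (h : G.Adj v z) (h' : G.Adj v w) :
    z = w := by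
  classical
  by_contra hne
  obtain ⟨W, h1, h2, h3⟩ := hH.near hl hG hw hz
  have hvW : v ∉ W.bypass.support := fun hm => hv (h3 _ (W.support_bypass_subset_support hm))
  have hc : (Walk.cons h.symm (Walk.cons h' W.bypass)).IsCycle := by
    rw [Walk.cons_isCycle_iff, Walk.cons_isPath_iff]
    refine ⟨⟨W.bypass_isPath, hvW⟩, ?_⟩
    rw [Walk.edges_cons, List.mem_cons, Sym2.eq_swap, Sym2.congr_right]
    rintro (he | he)
    · exact hne he
    · exact hvW (W.bypass.fst_mem_support_of_mem_edges he)
  have h3 := hG.le_length_of_isCycle hc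
  have h4 := W.length_bypass_le_length
  rw [Walk.length_cons, Walk.length_cons] at h3
  omega

end K4Subdivision

/-! ### Ears and the cycles they close. -/

/-- A path between two vertices of `S` whose other vertices lie outside `S` and are adjacent only to
their neighbours on the path, among all vertices of the path and of `S`. -/
structure IsEar (G : SimpleGraph V) (S : Set V) {x y : V} (R : G.Walk x y) : Prop where
  isPath : R.IsPath
  two_le : 2 ≤ R.length
  left_mem : x ∈ S
  right_mem : y ∈ S
  inter : ∀ z ∈ R.support, z ∈ S → z = x ∨ z = y
  adj : ∀ z ∈ R.support, z ∉ S → ∀ w, w ∈ R.support ∨ w ∈ S → G.Adj z w → s(z, w) ∈ R.edges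

theorem IsEar.isCycle_append {S : Set V} {x y : V} {R A : G.Walk x y} (hR : IsEar G S R)
    (hxy : x ≠ y) (hA : A.IsPath) (hAS : ∀ z ∈ A.support, z ∈ S) :
    (R.append A.reverse).IsCycle := by
  have h0 : A.length ≠ 0 := fun h => hxy (Walk.eq_of_length_eq_zero h)
  have h1 := hR.two_le
  refine OddK4.isCycle_append hR.isPath hA.reverse hxy (by simp; omega) fun z hz hzA => ?_
  exact hR.inter z hz (hAS z (by simpa using hzA))

theorem IsEar.isOddHole {l : ℕ} (hl : 2 ≤ l) (hG : InFamily l G) {S : Set V} {x y : V}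
    {R A : G.Walk x y} (hR : IsEar G S R)
    (hxy : x ≠ y) (hA : A.IsPath) (hAS : ∀ z ∈ A.support, z ∈ S) (hc : Chordless G A)
    (hodd : Odd (R.length + A.length)) : IsOddHole G (R.append A.reverse) := by
  have hcyc := hR.isCycle_append hxy hA hAS
  have hlen := hG.le_length_of_isCycle hcyc
  refine ⟨⟨hcyc, by omega, ?_⟩, by simpa using hodd⟩
  have key : ∀ z, z ∈ (R.append A.reverse).support → z ∉ S → z ∈ R.support := by
    intro z hz hzS
    simp only [Walk.mem_support_append_iff, Walk.support_reverse, List.mem_reverse] at hz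
    exact hz.resolve_right fun h => hzS (hAS z h)
  have key' : ∀ z, z ∈ (R.append A.reverse).support → z ∈ S → z ∈ A.support := by
    intro z hz hzS
    simp only [Walk.mem_support_append_iff, Walk.support_reverse, List.mem_reverse] at hz
    rcases hz with hz | hz
    · rcases hR.inter z hz hzS with rfl | rfl <;> simp
    · exact hz
  intro z hz w hw hzw
  simp only [Walk.edges_append, List.mem_append, Walk.edges_reverse, List.mem_reverse]
  have hz' : z ∈ R.support ∨ z ∈ S := by
    by_cases h : z ∈ S
    exacts [.inr h, .inl (key z hz h)]
  have hw' : w ∈ R.support ∨ w ∈ S := by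
    by_cases h : w ∈ S
    exacts [.inr h, .inl (key w hw h)]
  by_cases hzS : z ∈ S
  · by_cases hwS : w ∈ S
    · exact .inr (hc z (key' z hz hzS) w (key' w hw hwS) hzw)
    · left
      rw [Sym2.eq_swap]
      exact hR.adj w (key w hw hwS) hwS z hz' hzw.symm
  · exact .inl (hR.adj z (key z hz hzS) hzS w hw' hzw)

/-- The arithmetic form in which ears are used: each chordless path in $S$ yields a lower bound from
the girth and, in the odd case, an exact length. -/
theorem IsEar.length_add {l : ℕ} (hl : 2 ≤ l) (hG : InFamily l G) {S : Set V} {x y : V}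
    {R A : G.Walk x y} (hR : IsEar G S R)
    (hxy : x ≠ y) (hA : A.IsPath) (hAS : ∀ z ∈ A.support, z ∈ S) (hc : Chordless G A) :
    2 * l + 1 ≤ R.length + A.length ∧
      ((R.length + A.length) % 2 = 1 → R.length + A.length = 2 * l + 1) := by
  constructor
  · simpa using hG.le_length_of_isCycle (hR.isCycle_append hxy hA hAS)
  · intro h
    simpa using hG.length_of_isOddHole
      (hR.isOddHole hl hG hxy hA hAS hc (Nat.odd_iff.2 h))

theorem eq_of_mem_of_isPath_append {u v w z : V} {p : G.Walk u v} {q : G.Walk v w}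
    (h : (p.append q).IsPath) (hp : z ∈ p.support) (hq : z ∈ q.support) : z = v := by
  rw [Walk.isPath_def, Walk.support_append, List.nodup_append] at h
  rw [← Walk.cons_tail_support, List.mem_cons] at hq
  rcases hq with hq | hq
  · exact hq
  · exact absurd rfl (h.2.2 z hp z hq)

theorem length_eq_one_of_edge_of_mem {u v z w : V} {p : G.Walk u v} (hp : p.IsPath)
    (h : s(z, w) ∈ p.edges) (hz : z = u ∨ z = v) (hw : w = u ∨ w = v) : p.length = 1 := by
  have hne := (p.adj_of_mem_edges h).ne
  rcases hz with rfl | rfl <;> rcases hw with rfl | rfl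
  · exact absurd rfl hne
  · exact length_eq_one_of_edge hp h
  · exact length_eq_one_of_edge hp (by rwa [Sym2.eq_swap])
  · exact absurd rfl hne

theorem split_facts {a b x : V} {P : G.Walk a b} {A : G.Walk a x} {A' : G.Walk x b}
    (hP : P.IsPath) (hA : P = A.append A') :
    A.IsPath ∧ A'.IsPath ∧ (∀ z ∈ A.support, z ∈ A'.support → z = x) ∧
      (∀ z, z ∈ P.support ↔ z ∈ A.support ∨ z ∈ A'.support) ∧
      a ∈ A.support ∧ x ∈ A.support ∧ x ∈ A'.support ∧ b ∈ A'.support := by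
  subst hA
  exact ⟨hP.of_append_left, hP.of_append_right, fun z => eq_of_mem_of_isPath_append hP,
    fun z => Walk.mem_support_append_iff _ _, A.start_mem_support, A.end_mem_support,
    A'.start_mem_support, A'.end_mem_support⟩

/-! ### Ears from $L_1$ to the inside of $P_2$. -/

namespace K4Subdivision

variable {H : K4Subdivision G}

/-- Since $H$ is induced, only edges of $H$ can be chords. -/
theorem IsOdd.chordless {l : ℕ} (hl : 4 ≤ l) (hG : InFamily l G) (hH : H.IsOdd) {x y : V}
    {W : G.Walk x y} (hW : ∀ z ∈ W.support, z ∈ H.verts)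
    (h : ∀ z w, z ≠ w → z ∈ W.support → w ∈ W.support → s(z, w) ∈ H.edges → s(z, w) ∈ W.edges) :
    Chordless G W :=
  fun z hz w hw hzw => h z w hzw.ne hz hw (hH.edge_mem hl hG (hW z hz) (hW w hw) hzw)

section splitL

variable {l : ℕ} {x y : V} {A : G.Walk H.u₁ x} {A' : G.Walk x H.u₃} {B : G.Walk H.u₃ y}
  {B' : G.Walk y H.u₄}

theorem chordless_L₁_P₂ (hl : 4 ≤ l) (hG : InFamily l G) (hH : H.IsOdd)
    (hA : H.L₁ = A.append A') (hB : H.P₂ = B.append B') (hy4 : y ≠ H.u₄) :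
    (A'.append B).IsPath ∧ (∀ z ∈ (A'.append B).support, z ∈ H.verts) ∧
      Chordless G (A'.append B) := by
  obtain ⟨pA, pA', jA, mA, eA1, eA2, eA3, eA4⟩ := split_facts H.isPath_L₁ hA
  obtain ⟨pB, pB', jB, mB, eB1, eB2, eB3, eB4⟩ := split_facts H.isPath_P₂ hB
  obtain ⟨i1, i2, i3, i4, i5, i6, i7, i8, i9, i10, i11, i12, i13, i14, i15⟩ := H.arris_inter
  have hv : ∀ z ∈ (A'.append B).support, z ∈ H.verts := by
    intro z hz
    rw [Walk.mem_support_append_iff] at hz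
    simp only [verts, Set.mem_ofPred_eq, mA, mB]
    tauto
  refine ⟨isPath_append pA' pB (by grind), hv, hH.chordless hl hG hv ?_⟩
  intro z w hne hz hw he
  simp only [edges, hA, hB, Walk.edges_append, List.mem_append, Set.mem_ofPred_eq] at he
  rw [Walk.mem_support_append_iff] at hz hw
  simp only [Walk.edges_append, List.mem_append]
  clear hv hA hB hH hG
  rcases he with e | (e | e) | e | e | (e | e) | e
  all_goals
    have m1 := Walk.fst_mem_support_of_mem_edges _ e
    have m2 := Walk.snd_mem_support_of_mem_edges _ e
    grind

/-- The dangerous chord is $u_3y$: it occurs when $x=u_3$ and `B` is a single edge. -/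
theorem chordless_L₁_Q₂_P₂ (hl : 4 ≤ l) (hG : InFamily l G) (hH : H.IsOdd)
    (hA : H.L₁ = A.append A') (hB : H.P₂ = B.append B') (hy3 : y ≠ H.u₃)
    (hx : x = H.u₃ → B.length ≠ 1) :
    ((A.reverse.append H.Q₂).append B'.reverse).IsPath ∧
      (∀ z ∈ ((A.reverse.append H.Q₂).append B'.reverse).support, z ∈ H.verts) ∧
      Chordless G ((A.reverse.append H.Q₂).append B'.reverse) := by
  obtain ⟨pA, pA', jA, mA, eA1, eA2, eA3, eA4⟩ := split_facts H.isPath_L₁ hA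
  obtain ⟨pB, pB', jB, mB, eB1, eB2, eB3, eB4⟩ := split_facts H.isPath_P₂ hB
  obtain ⟨i1, i2, i3, i4, i5, i6, i7, i8, i9, i10, i11, i12, i13, i14, i15⟩ := H.arris_inter
  obtain ⟨n1, n2, n3, n4, n5, n6⟩ := H.branch_ne
  have a1 := H.Q₂.start_mem_support
  have a2 := H.Q₂.end_mem_support
  have hv : ∀ z ∈ ((A.reverse.append H.Q₂).append B'.reverse).support, z ∈ H.verts := by
    intro z hz
    simp only [Walk.mem_support_append_iff, Walk.support_reverse, List.mem_reverse] at hz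
    simp only [verts, Set.mem_ofPred_eq, mA, mB]
    tauto
  refine ⟨isPath_append (isPath_append pA.reverse H.isPath_Q₂ ?_) pB'.reverse ?_, hv,
    hH.chordless hl hG hv ?_⟩
  · simp only [Walk.support_reverse, List.mem_reverse]
    grind
  · simp only [Walk.mem_support_append_iff, Walk.support_reverse, List.mem_reverse]
    grind
  intro z w hne hz hw he
  have oB := fun z w => length_eq_one_of_edge_of_mem (z := z) (w := w) pB
  simp only [edges, hA, hB, Walk.edges_append, List.mem_append, Set.mem_ofPred_eq] at he
  simp only [Walk.mem_support_append_iff, Walk.support_reverse, List.mem_reverse] at hz hw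
  simp only [Walk.edges_append, List.mem_append, Walk.edges_reverse, List.mem_reverse]
  clear hv hA hB hH hG
  rcases he with e | (e | e) | e | e | (e | e) | e
  all_goals
    have m1 := Walk.fst_mem_support_of_mem_edges _ e
    have m2 := Walk.snd_mem_support_of_mem_edges _ e
    first | (clear oB; grind) | (replace oB := oB z w e; grind)

/-- The path meets both ends of `A'`, so `A'` must not be a single edge. -/
theorem chordless_L₁_P₁_Q₁_P₂ (hl : 4 ≤ l) (hG : InFamily l G) (hH : H.IsOdd)
    (hA : H.L₁ = A.append A') (hB : H.P₂ = B.append B') (hy4 : y ≠ H.u₄)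
    (hx : x ≠ H.u₃) (hx' : A'.length ≠ 1) :
    (((A.reverse.append H.P₁).append H.Q₁).append B).IsPath ∧
      (∀ z ∈ (((A.reverse.append H.P₁).append H.Q₁).append B).support, z ∈ H.verts) ∧
      Chordless G (((A.reverse.append H.P₁).append H.Q₁).append B) := by
  obtain ⟨pA, pA', jA, mA, eA1, eA2, eA3, eA4⟩ := split_facts H.isPath_L₁ hA
  obtain ⟨pB, pB', jB, mB, eB1, eB2, eB3, eB4⟩ := split_facts H.isPath_P₂ hB
  obtain ⟨i1, i2, i3, i4, i5, i6, i7, i8, i9, i10, i11, i12, i13, i14, i15⟩ := H.arris_inter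
  obtain ⟨n1, n2, n3, n4, n5, n6⟩ := H.branch_ne
  have a1 := H.P₁.start_mem_support
  have a2 := H.P₁.end_mem_support
  have a3 := H.Q₁.start_mem_support
  have a4 := H.Q₁.end_mem_support
  have hv : ∀ z ∈ (((A.reverse.append H.P₁).append H.Q₁).append B).support, z ∈ H.verts := by
    intro z hz
    simp only [Walk.mem_support_append_iff, Walk.support_reverse, List.mem_reverse] at hz
    simp only [verts, Set.mem_ofPred_eq, mA, mB]
    tauto
  refine ⟨isPath_append (isPath_append (isPath_append pA.reverse H.isPath_P₁ ?_) H.isPath_Q₁ ?_)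
    pB ?_, hv, hH.chordless hl hG hv ?_⟩
  iterate 3
    simp only [Walk.mem_support_append_iff, Walk.support_reverse, List.mem_reverse]
    grind
  intro z w hne hz hw he
  have oA' := fun z w => length_eq_one_of_edge_of_mem (z := z) (w := w) pA'
  simp only [edges, hA, hB, Walk.edges_append, List.mem_append, Set.mem_ofPred_eq] at he
  simp only [Walk.mem_support_append_iff, Walk.support_reverse, List.mem_reverse] at hz hw
  simp only [Walk.edges_append, List.mem_append, Walk.edges_reverse, List.mem_reverse]
  clear hv hA hB hH hG
  rcases he with e | (e | e) | e | e | (e | e) | e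
  all_goals
    have m1 := Walk.fst_mem_support_of_mem_edges _ e
    have m2 := Walk.snd_mem_support_of_mem_edges _ e
    first | (clear oA'; grind) | (replace oA' := oA' z w e; grind)

/-- The path contains both ends of $Q_2$, and of $Q_1$ when $x=u_3$, so single-edge arrises have to
be excluded there, as does the chord $u_3y$. -/
theorem chordless_L₁_P₁_L₂_P₂ (hl : 4 ≤ l) (hG : InFamily l G) (hH : H.IsOdd)
    (hA : H.L₁ = A.append A') (hB : H.P₂ = B.append B') (hy3 : y ≠ H.u₃)
    (hx : x = H.u₃ → B.length ≠ 1) (hQ₁ : H.Q₁.length ≠ 1) (hQ₂ : H.Q₂.length ≠ 1) :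
    (((A.reverse.append H.P₁).append H.L₂).append B'.reverse).IsPath ∧
      (∀ z ∈ (((A.reverse.append H.P₁).append H.L₂).append B'.reverse).support, z ∈ H.verts) ∧
      Chordless G (((A.reverse.append H.P₁).append H.L₂).append B'.reverse) := by
  obtain ⟨pA, pA', jA, mA, eA1, eA2, eA3, eA4⟩ := split_facts H.isPath_L₁ hA
  obtain ⟨pB, pB', jB, mB, eB1, eB2, eB3, eB4⟩ := split_facts H.isPath_P₂ hB
  obtain ⟨i1, i2, i3, i4, i5, i6, i7, i8, i9, i10, i11, i12, i13, i14, i15⟩ := H.arris_inter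
  obtain ⟨n1, n2, n3, n4, n5, n6⟩ := H.branch_ne
  have a1 := H.P₁.start_mem_support
  have a2 := H.P₁.end_mem_support
  have a3 := H.L₂.start_mem_support
  have a4 := H.L₂.end_mem_support
  have hv : ∀ z ∈ (((A.reverse.append H.P₁).append H.L₂).append B'.reverse).support,
      z ∈ H.verts := by
    intro z hz
    simp only [Walk.mem_support_append_iff, Walk.support_reverse, List.mem_reverse] at hz
    simp only [verts, Set.mem_ofPred_eq, mA, mB]
    tauto
  refine ⟨isPath_append (isPath_append (isPath_append pA.reverse H.isPath_P₁ ?_) H.isPath_L₂ ?_)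
    pB'.reverse ?_, hv, hH.chordless hl hG hv ?_⟩
  iterate 3
    simp only [Walk.mem_support_append_iff, Walk.support_reverse, List.mem_reverse]
    grind
  intro z w hne hz hw he
  have oB := fun z w => length_eq_one_of_edge_of_mem (z := z) (w := w) pB
  have oQ₁ := fun z w => length_eq_one_of_edge_of_mem (z := z) (w := w) H.isPath_Q₁
  have oQ₂ := fun z w => length_eq_one_of_edge_of_mem (z := z) (w := w) H.isPath_Q₂
  simp only [edges, hA, hB, Walk.edges_append, List.mem_append, Set.mem_ofPred_eq] at he
  simp only [Walk.mem_support_append_iff, Walk.support_reverse, List.mem_reverse] at hz hw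
  simp only [Walk.edges_append, List.mem_append, Walk.edges_reverse, List.mem_reverse]
  clear hv hA hB hH hG
  rcases he with e | (e | e) | e | e | (e | e) | e
  all_goals
    have m1 := Walk.fst_mem_support_of_mem_edges _ e
    have m2 := Walk.snd_mem_support_of_mem_edges _ e
  · clear oB oQ₁ oQ₂; grind
  · clear oQ₁ oQ₂; replace oB := oB z w e; grind
  · clear oB oQ₁ oQ₂; grind
  · clear oB oQ₂; replace oQ₁ := oQ₁ z w e; grind
  · clear oB oQ₁; replace oQ₂ := oQ₂ z w e; grind
  all_goals
    clear oB oQ₁ oQ₂; grind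

theorem IsOdd.ear_L₁ (hl : 4 ≤ l) (hG : InFamily l G) (hH : H.IsOdd)
    (hPQ : H.P₂.length ≤ H.Q₂.length) (hPL : H.P₂.length ≤ H.L₁.length) {R : G.Walk x y}
    (hR : IsEar G H.verts R) (hx : x ∈ H.L₁.support) (hy : y ∈ innerVerts H.P₂) :
    x = H.u₃ ∧ G.Adj x y := by
  obtain ⟨h1, h2, h3, h4⟩ := hH.lengths hG
  obtain ⟨hyP, hy3, hy4⟩ := hy
  obtain ⟨A, A', hA⟩ := Walk.mem_support_iff_exists_append.1 hx
  obtain ⟨B, B', hB⟩ := Walk.mem_support_iff_exists_append.1 hyP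
  have hAl := congrArg Walk.length hA
  have hBl := congrArg Walk.length hB
  rw [Walk.length_append] at hAl hBl
  by_contra hcon
  -- The negated conclusion excludes exactly the chord $u_3y$.
  have x3 : x = H.u₃ → B.length ≠ 1 := by
    intro h h'
    have := B.adj_of_length_eq_one h'
    exact hcon ⟨h, h ▸ this⟩
  have lB : B.length ≠ 0 := fun h => hy3 (Walk.eq_of_length_eq_zero h).symm
  have lB' : B'.length ≠ 0 := fun h => hy4 (Walk.eq_of_length_eq_zero h)
  have hxy : x ≠ y := by
    rintro rfl
    have : ∀ z ∈ H.P₂.support, z ∈ H.L₁.support → z = H.u₃ := by have := H.arris_inter; tauto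
    exact hy3 (this x hyP hx)
  obtain ⟨c1, c2, c3⟩ := chordless_L₁_P₂ hl hG hH hA hB hy4
  obtain ⟨d1, d2, d3⟩ := chordless_L₁_Q₂_P₂ hl hG hH hA hB hy3 x3
  -- As $y$ is internal, $|P_2|\ge 2$; hence $|Q_1|=|Q_2|\ge 2$.
  obtain ⟨e1, e2, e3⟩ := chordless_L₁_P₁_L₂_P₂ hl hG hH hA hB hy3 x3 (by omega) (by omega)
  have c := hR.length_add (by omega) hG hxy c1 c2 c3
  have d := hR.length_add (by omega) hG hxy d1 d2 d3
  have e := hR.length_add (by omega) hG hxy e1 e2 e3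
  simp only [Walk.length_append, Walk.length_reverse] at c d e
  -- Exactly one of the cycles in `c` and `d` is odd, since their lengths sum to $2|R|+2l+1$. If `c`
  -- is odd, so is `e`, and equating their lengths forces `B'` to be empty. If `d` is odd, so is `f`
  -- when its path is chordless, and equating their lengths forces `B` to be empty.
  by_cases hx3 : x ≠ H.u₃ ∧ A'.length ≠ 1
  · obtain ⟨f1, f2, f3⟩ := chordless_L₁_P₁_Q₁_P₂ hl hG hH hA hB hy4 hx3.1 hx3.2
    have f := hR.length_add (by omega) hG hxy f1 f2 f3
    simp only [Walk.length_append, Walk.length_reverse] at f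
    omega
  · have : A'.length ≤ 1 := by
      by_cases h : x = H.u₃
      · subst h
        have := Walk.length_eq_zero_iff.2 (Walk.isPath_iff_nil.1 (split_facts H.isPath_L₁ hA).2.1)
        omega
      · by_contra h'
        exact hx3 ⟨h, by omega⟩
    -- Here `f` is unavailable, but $|A'|\le 1$. If `d` is odd, then `c` is even and longer, so
    -- $|A'|+|B|>|A|+|Q_2|+|B'|$, contradicting $|B|<|P_2|\le|Q_2|$.
    omega

end splitL
end K4Subdivision

/-! ### Ears between the insides of $P_1$ and $P_2$, and rerouting. -/

namespace K4Subdivision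

variable {H : K4Subdivision G} {l : ℕ} {x y : V} {A : G.Walk H.u₁ x} {A' : G.Walk x H.u₂}
  {B : G.Walk H.u₃ y} {B' : G.Walk y H.u₄}

theorem chordless_P₁_L₁_P₂ (hl : 4 ≤ l) (hG : InFamily l G) (hH : H.IsOdd)
    (hA : H.P₁ = A.append A') (hB : H.P₂ = B.append B') (hx : x ≠ H.u₂) (hy4 : y ≠ H.u₄) :
    ((A.reverse.append H.L₁).append B).IsPath ∧
      (∀ z ∈ ((A.reverse.append H.L₁).append B).support, z ∈ H.verts) ∧
      Chordless G ((A.reverse.append H.L₁).append B) := by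
  obtain ⟨pA, pA', jA, mA, eA1, eA2, eA3, eA4⟩ := split_facts H.isPath_P₁ hA
  obtain ⟨pB, pB', jB, mB, eB1, eB2, eB3, eB4⟩ := split_facts H.isPath_P₂ hB
  obtain ⟨i1, i2, i3, i4, i5, i6, i7, i8, i9, i10, i11, i12, i13, i14, i15⟩ := H.arris_inter
  obtain ⟨n1, n2, n3, n4, n5, n6⟩ := H.branch_ne
  have a1 := H.L₁.start_mem_support
  have a2 := H.L₁.end_mem_support
  have hv : ∀ z ∈ ((A.reverse.append H.L₁).append B).support, z ∈ H.verts := by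
    intro z hz
    simp only [Walk.mem_support_append_iff, Walk.support_reverse, List.mem_reverse] at hz
    simp only [verts, Set.mem_ofPred_eq, mA, mB]
    tauto
  refine ⟨isPath_append (isPath_append pA.reverse H.isPath_L₁ ?_) pB ?_, hv,
    hH.chordless hl hG hv ?_⟩
  iterate 2
    simp only [Walk.mem_support_append_iff, Walk.support_reverse, List.mem_reverse]
    grind
  intro z w hne hz hw he
  simp only [edges, hA, hB, Walk.edges_append, List.mem_append, Set.mem_ofPred_eq] at he
  simp only [Walk.mem_support_append_iff, Walk.support_reverse, List.mem_reverse] at hz hw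
  simp only [Walk.edges_append, List.mem_append, Walk.edges_reverse, List.mem_reverse]
  clear hv hA hB hH hG
  rcases he with (e | e) | (e | e) | e | e | e | e
  all_goals
    have m1 := Walk.fst_mem_support_of_mem_edges _ e
    have m2 := Walk.snd_mem_support_of_mem_edges _ e
    grind

theorem chordless_P₁_L₂_P₂ (hl : 4 ≤ l) (hG : InFamily l G) (hH : H.IsOdd)
    (hA : H.P₁ = A.append A') (hB : H.P₂ = B.append B') (hx : x ≠ H.u₁) (hy : y ≠ H.u₃) :
    ((A'.append H.L₂).append B'.reverse).IsPath ∧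
      (∀ z ∈ ((A'.append H.L₂).append B'.reverse).support, z ∈ H.verts) ∧
      Chordless G ((A'.append H.L₂).append B'.reverse) := by
  have h := chordless_P₁_L₁_P₂ (H := H.swapLeft.swapRight) (A := A'.reverse) (A' := A.reverse)
    (B := B'.reverse) (B' := B.reverse) hl hG hH.swapLeft.swapRight
    (by simp [swapLeft, swapRight, hA]) (by simp [swapLeft, swapRight, hB]) hx hy
  rw [verts_swapRight, verts_swapLeft] at h
  have h' : ((A'.reverse.reverse.append H.L₂).append B'.reverse).IsPath ∧
      (∀ z ∈ ((A'.reverse.reverse.append H.L₂).append B'.reverse).support, z ∈ H.verts) ∧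
      Chordless G ((A'.reverse.reverse.append H.L₂).append B'.reverse) := h
  rwa [Walk.reverse_reverse] at h'

/-- The subdivision obtained by replacing `Q₁` by a path from the inside of `P₁` to the inside of
`P₂`. -/
def reroute (H : K4Subdivision G) {x y : V} (A : G.Walk H.u₁ x) (A' : G.Walk x H.u₂)
    (B : G.Walk H.u₃ y) (B' : G.Walk y H.u₄) (R : G.Walk x y)
    (hA : H.P₁ = A.append A') (hB : H.P₂ = B.append B') (hR : IsEar G H.verts R)
    (hx : x ∈ innerVerts H.P₁) (hy : y ∈ innerVerts H.P₂) : K4Subdivision G where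
  u₁ := H.u₁
  u₂ := x
  u₃ := y
  u₄ := H.u₄
  P₁ := A
  P₂ := B'
  Q₁ := R
  Q₂ := H.Q₂
  L₁ := H.L₁.append B
  L₂ := A'.append H.L₂
  isPath_P₁ := (split_facts H.isPath_P₁ hA).1
  isPath_P₂ := (split_facts H.isPath_P₂ hB).2.1
  isPath_Q₁ := hR.isPath
  isPath_Q₂ := H.isPath_Q₂
  isPath_L₁ := by
    obtain ⟨pB, pB', jB, mB, -⟩ := split_facts H.isPath_P₂ hB
    have i : ∀ z ∈ H.P₂.support, z ∈ H.L₁.support → z = H.u₃ := by have := H.arris_inter; tauto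
    exact isPath_append H.isPath_L₁ pB (by grind)
  isPath_L₂ := by
    obtain ⟨pA, pA', jA, mA, -⟩ := split_facts H.isPath_P₁ hA
    have i : ∀ z ∈ H.P₁.support, z ∈ H.L₂.support → z = H.u₂ := by have := H.arris_inter; tauto
    exact isPath_append pA' H.isPath_L₂ (by grind)
  distinct := by
    have i1 := H.arris_inter.1
    obtain ⟨n1, n2, n3, n4, n5, n6⟩ := H.branch_ne
    obtain ⟨hx, hx1, hx2⟩ := hx
    obtain ⟨hy, hy3, hy4⟩ := hy
    have := H.P₂.end_mem_support
    have := H.P₁.start_mem_support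
    simp only [List.nodup_cons, List.mem_cons, List.not_mem_nil, or_false, not_or, List.nodup_nil,
      not_false_eq_true, and_true]
    grind
  branch_notMem := by
    obtain ⟨pA, pA', jA, mA, eA1, eA2, eA3, eA4⟩ := split_facts H.isPath_P₁ hA
    obtain ⟨pB, pB', jB, mB, eB1, eB2, eB3, eB4⟩ := split_facts H.isPath_P₂ hB
    obtain ⟨i1, i2, i3, i4, i5, i6, i7, i8, i9, i10, i11, i12, i13, i14, i15⟩ := H.arris_inter
    obtain ⟨n1, n2, n3, n4, n5, n6⟩ := H.branch_ne
    obtain ⟨hx, hx1, hx2⟩ := hx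
    obtain ⟨hy, hy3, hy4⟩ := hy
    have q1 := H.Q₂.start_mem_support
    have q2 := H.Q₂.end_mem_support
    have q3 := H.L₂.start_mem_support
    have q4 := H.L₂.end_mem_support
    have q5 := H.L₁.start_mem_support
    have q6 := H.L₁.end_mem_support
    have r := hR.inter
    simp only [verts, Set.mem_ofPred_eq] at r
    clear hA hB hR
    simp only [List.mem_cons, List.not_mem_nil, or_false, forall_eq_or_imp, forall_eq, innerVerts,
      Set.mem_ofPred_eq, Walk.mem_support_append_iff]
    refine ⟨⟨?_, ?_, ?_, ?_, ?_, ?_⟩, ⟨?_, ?_, ?_, ?_, ?_, ?_⟩, ⟨?_, ?_, ?_, ?_, ?_, ?_⟩,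
      ?_, ?_, ?_, ?_, ?_, ?_⟩ <;> grind
  disjoint_innerVerts := by
    obtain ⟨pA, pA', jA, mA, eA1, eA2, eA3, eA4⟩ := split_facts H.isPath_P₁ hA
    obtain ⟨pB, pB', jB, mB, eB1, eB2, eB3, eB4⟩ := split_facts H.isPath_P₂ hB
    obtain ⟨i1, i2, i3, i4, i5, i6, i7, i8, i9, i10, i11, i12, i13, i14, i15⟩ := H.arris_inter
    obtain ⟨n1, n2, n3, n4, n5, n6⟩ := H.branch_ne
    obtain ⟨hx, hx1, hx2⟩ := hx
    obtain ⟨hy, hy3, hy4⟩ := hy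
    have r := hR.inter
    simp only [verts, Set.mem_ofPred_eq] at r
    clear hA hB hR
    simp only [List.pairwise_cons, List.mem_cons, List.not_mem_nil, or_false, forall_eq_or_imp,
      forall_eq, Set.disjoint_left, innerVerts, Set.mem_ofPred_eq, Walk.mem_support_append_iff,
      List.Pairwise.nil, and_true, IsEmpty.forall_iff, implies_true]
    refine ⟨⟨?_, ?_, ?_, ?_, ?_⟩, ⟨?_, ?_, ?_, ?_⟩, ⟨?_, ?_, ?_⟩, ⟨?_, ?_⟩, ?_⟩ <;>
      intro z hz hw <;> grind

/-- The cycles of $R$ through $L_1$ and through $L_2$ have lengths summing to $2(|R|+|P_1|+|L_1|)$,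
so both are odd. They are two faces of the rerouted subdivision; the other two faces are those of
$H$ avoiding $Q_1$. -/
theorem IsOdd.not_ear_P₁_of_odd (hl : 4 ≤ l) (hG : InFamily l G) (hH : H.IsOdd)
    (hmin : ∀ H' : K4Subdivision G, H'.IsOdd → H.P₂.length ≤ H'.P₂.length)
    {R : G.Walk x y} (hR : IsEar G H.verts R)
    (hA : H.P₁ = A.append A') (hB : H.P₂ = B.append B')
    (hx : x ∈ innerVerts H.P₁) (hy : y ∈ innerVerts H.P₂)
    (hodd : (R.length + A.length + H.L₁.length + B.length) % 2 = 1) : False := by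
  obtain ⟨h1, h2, h3, h4⟩ := hH.lengths hG
  have hAl := congrArg Walk.length hA
  have hBl := congrArg Walk.length hB
  rw [Walk.length_append] at hAl hBl
  have hxy : x ≠ y := fun h => H.arris_inter.1 x hx.1 (h ▸ hy.1)
  obtain ⟨c1, c2, c3⟩ := chordless_P₁_L₁_P₂ hl hG hH hA hB hx.2.2 hy.2.2
  obtain ⟨d1, d2, d3⟩ := chordless_P₁_L₂_P₂ hl hG hH hA hB hx.2.1 hy.2.1
  have c := hR.length_add (by omega) hG hxy c1 c2 c3
  have d := hR.length_add (by omega) hG hxy d1 d2 d3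
  have c' := hR.isOddHole (by omega) hG hxy c1 c2 c3
    (by rw [Nat.odd_iff]; simp only [Walk.length_append, Walk.length_reverse]; omega)
  have d' := hR.isOddHole (by omega) hG hxy d1 d2 d3 (by
    rw [Nat.odd_iff]; simp only [Walk.length_append, Walk.length_reverse] at c ⊢; omega)
  have hodd' : (H.reroute A A' B B' R hA hB hR hx hy).IsOdd := by
    refine ⟨?_, ?_, ?_, ?_⟩
    · simp only [Walk.reverse_append, Walk.reverse_reverse] at c'
      rw [Walk.append_assoc, Walk.append_assoc] at c'
      simpa [reroute, C₁, Walk.append_assoc] using c'.append_comm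
    · simpa [reroute, C₂, hA, Walk.append_assoc] using hH.oddHole_C₂
    · simpa [reroute, C₃, Walk.append_assoc] using d'
    · simpa [reroute, C₄, hB, Walk.append_assoc] using hH.oddHole_C₄
  have := hmin _ hodd'
  -- The new $P_2$ is `B'`, shorter than the old one by $|B|>0$.
  have hB0 : B.length ≠ 0 := fun h => hy.2.1 (Walk.eq_of_length_eq_zero h).symm
  simp only [reroute] at this
  omega

theorem IsOdd.not_ear_P₁ (hl : 4 ≤ l) (hG : InFamily l G) (hH : H.IsOdd)
    (hmin : ∀ H' : K4Subdivision G, H'.IsOdd → H.P₂.length ≤ H'.P₂.length)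
    {R : G.Walk x y} (hR : IsEar G H.verts R)
    (hx : x ∈ innerVerts H.P₁) (hy : y ∈ innerVerts H.P₂) : False := by
  obtain ⟨h1, h2, h3, h4⟩ := hH.lengths hG
  obtain ⟨A, A', hA⟩ := Walk.mem_support_iff_exists_append.1 hx.1
  obtain ⟨B, B', hB⟩ := Walk.mem_support_iff_exists_append.1 hy.1
  have hAl := congrArg Walk.length hA
  rw [Walk.length_append] at hAl
  -- The cycles of $R$ through $L_1$ and through $Q_1$ that both use `B` have lengths summing to an
  -- odd number; if the first is even, interchanging $u_1$ and $u_2$ makes the odd one play its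
  -- role.
  by_cases hodd : (R.length + A.length + H.L₁.length + B.length) % 2 = 1
  · exact hH.not_ear_P₁_of_odd hl hG hmin hR hA hB hx hy hodd
  · refine IsOdd.not_ear_P₁_of_odd (H := H.swapLeft) (A := A'.reverse) (A' := A.reverse) (B := B) (B' := B')
      (R := R) hl hG hH.swapLeft hmin ?_ ?_ hB ?_ hy ?_
    · rwa [verts_swapLeft]
    · simp [K4Subdivision.swapLeft, hA]
    · exact (innerVerts_reverse H.P₁).symm ▸ hx
    · simp only [K4Subdivision.swapLeft, Walk.length_reverse]
      omega

end K4Subdivision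

/-! ### Arbitrary ears into $P_2^*$, and direct connections. -/

namespace K4Subdivision

variable {H : K4Subdivision G} {l : ℕ} {x y : V}

theorem IsOdd.ear (hl : 4 ≤ l) (hG : InFamily l G) (hH : H.IsOdd)
    (hmin : ∀ H' : K4Subdivision G, H'.IsOdd → H.P₂.length ≤ H'.P₂.length)
    {R : G.Walk x y} (hR : IsEar G H.verts R)
    (hx : x ∉ innerVerts H.P₂) (hy : y ∈ innerVerts H.P₂) :
    (x = H.u₃ ∨ x = H.u₄) ∧ G.Adj x y := by
  obtain ⟨h1, h2, h3, h4⟩ := hH.lengths hG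
  -- Relabelling by `cyc` puts another arris in the place of $P_2$, so minimality makes $P_2$ a
  -- shortest arris.
  have hQ : H.P₂.length ≤ H.Q₂.length := hmin _ hH.cyc
  have hL : H.P₂.length ≤ H.L₂.length := hmin _ hH.cyc.cyc
  have hRl : IsEar G H.swapLeft.verts R := by rwa [verts_swapLeft]
  have hRr : IsEar G H.swapRight.verts R := by rwa [verts_swapRight]
  have hRlr : IsEar G H.swapLeft.swapRight.verts R := by rwa [verts_swapRight, verts_swapLeft]
  have hy' : y ∈ innerVerts H.P₂.reverse := (innerVerts_reverse H.P₂).symm ▸ hy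
  have cL₁ : x ∈ H.L₁.support → (x = H.u₃ ∨ x = H.u₄) ∧ G.Adj x y := fun h =>
    (hH.ear_L₁ hl hG hQ (by omega) hR h hy).imp .inl id
  have cQ₁ : x ∈ H.Q₁.support → (x = H.u₃ ∨ x = H.u₄) ∧ G.Adj x y := fun h =>
    (ear_L₁ (H := H.swapLeft) hl hG hH.swapLeft hL (hQ.trans h2.le) hRl h hy).imp .inl id
  have hr : H.P₂.reverse.length = H.P₂.length := Walk.length_reverse _
  have cQ₂ : x ∈ H.Q₂.support → (x = H.u₃ ∨ x = H.u₄) ∧ G.Adj x y := fun h =>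
    (ear_L₁ (H := H.swapRight) hl hG hH.swapRight (hr.trans_le (hL.trans h3.le))
      (hr.trans_le hQ) hRr h hy').imp .inr id
  have cL₂ : x ∈ H.L₂.support → (x = H.u₃ ∨ x = H.u₄) ∧ G.Adj x y := fun h =>
    (ear_L₁ (H := H.swapLeft.swapRight) hl hG hH.swapLeft.swapRight
      (hr.trans_le (hQ.trans h2.le)) (hr.trans_le hL) hRlr h hy').imp .inr id
  rcases hR.left_mem with h | h | h | h | h | h
  · rcases eq_or_eq_or_mem_innerVerts h with h | h | h
    · exact cL₁ (h ▸ H.L₁.start_mem_support)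
    · exact cQ₁ (h ▸ H.Q₁.start_mem_support)
    · exact (hH.not_ear_P₁ hl hG hmin hR h hy).elim
  · rcases eq_or_eq_or_mem_innerVerts h with h | h | h
    · exact cL₁ (h ▸ H.L₁.end_mem_support)
    · exact cL₂ (h ▸ H.L₂.end_mem_support)
    · exact absurd h hx
  · exact cQ₁ h
  · exact cQ₂ h
  · exact cL₁ h
  · exact cL₂ h

theorem innerVerts_subset_verts : innerVerts H.P₂ ⊆ H.verts := fun _ h => .inr (.inl h.1)

/-- An inner vertex of `P₂` sends edges of `H` only along `P₂`. -/
theorem IsOdd.edge_mem_P₂ (hl : 4 ≤ l) (hG : InFamily l G) (hH : H.IsOdd) (hx : x ∈ H.verts)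
    (hy : y ∈ innerVerts H.P₂) (h : G.Adj x y) : s(x, y) ∈ H.P₂.edges := by
  have he := hH.edge_mem hl hG hx (innerVerts_subset_verts hy) h
  obtain ⟨i1, i2, i3, i4, i5, i6, i7, i8, i9, i10, i11, i12, i13, i14, i15⟩ := H.arris_inter
  obtain ⟨hyP, hy3, hy4⟩ := hy
  simp only [edges, Set.mem_ofPred_eq] at he
  rcases he with e | e | e | e | e | e
  all_goals
    have m2 := Walk.snd_mem_support_of_mem_edges _ e
    grind

/-- Only one edge of $P_2$ leaves each of its ends. This identifies $N_{P_2^*}(\{x\})$ with $\{y\}$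
for direct connections. -/
theorem IsOdd.eq_of_adj_end (hl : 4 ≤ l) (hG : InFamily l G) (hH : H.IsOdd)
    (hx : x = H.u₃ ∨ x = H.u₄) {w : V} (hy : y ∈ innerVerts H.P₂) (hw : w ∈ innerVerts H.P₂)
    (hxy : G.Adj x y) (hxw : G.Adj x w) : w = y := by
  have hxv : x ∈ H.verts := by
    rcases hx with rfl | rfl
    · exact .inr (.inl H.P₂.start_mem_support)
    · exact .inr (.inl H.P₂.end_mem_support)
  have h1 := hH.edge_mem_P₂ hl hG hxv hy hxy
  have h2 := hH.edge_mem_P₂ hl hG hxv hw hxw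
  rcases hx with rfl | rfl
  · exact isPath_eq_of_edge_start H.isPath_P₂ h2 h1
  · exact isPath_eq_of_edge_start H.isPath_P₂.reverse (by simpa using h2) (by simpa using h1)

end K4Subdivision

/-- A path outside `S` whose ends have unique neighbours `x` and `y` in `S`, and whose inner
vertices have none, extends to an ear. -/
theorem exists_isEar {S : Set V} {x y v₁ v₂ : V} {P : G.Walk v₁ v₂} (hP : P.IsPath)
    (hc : Chordless G P) (hPS : ∀ z ∈ P.support, z ∉ S) (hx : x ∈ S) (hy : y ∈ S) (hxy : x ≠ y)
    (h₁ : G.Adj v₁ x) (h₂ : G.Adj v₂ y)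
    (h : ∀ z ∈ P.support, ∀ s ∈ S, G.Adj z s → (z = v₁ ∧ s = x) ∨ (z = v₂ ∧ s = y)) :
    ∃ R : G.Walk x y, IsEar G S R := by
  have hxP : x ∉ P.support := fun h => hPS x h hx
  have hyP : y ∉ P.support := fun h => hPS y h hy
  refine ⟨Walk.cons h₁.symm (P.concat h₂), ?_, by simp, hx, hy, ?_, ?_⟩
  · rw [Walk.cons_isPath_iff, Walk.support_concat]
    refine ⟨hP.concat hyP h₂, ?_⟩
    simp [hxP, hxy]
  · intro z hz hzS
    simp only [Walk.support_cons, Walk.support_concat, List.mem_cons, List.mem_append,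
      List.not_mem_nil, or_false] at hz
    rcases hz with hz | hz | hz
    exacts [.inl hz, absurd hzS (hPS z hz), .inr hz]
  · intro z hz hzS w hw hzw
    simp only [Walk.support_cons, Walk.support_concat, List.mem_cons, List.mem_append,
      List.not_mem_nil, or_false] at hz hw
    have hzP : z ∈ P.support := by
      rcases hz with rfl | hz | rfl
      exacts [absurd hx hzS, hz, absurd hy hzS]
    have hwP : w ∈ P.support ∨ w ∈ S := by
      rcases hw with (rfl | hw | rfl) | hw
      exacts [.inr hx, .inl hw, .inr hy, .inr hw]
    simp only [Walk.edges_cons, Walk.edges_concat, List.concat_eq_append, List.mem_cons, List.mem_append,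
      List.not_mem_nil, or_false]
    rcases hwP with hwP | hwS
    · exact .inr (.inl (hc z hzP w hwP hzw))
    · rcases h z hzP w hwS hzw with ⟨rfl, rfl⟩ | ⟨rfl, rfl⟩
      · exact .inl Sym2.eq_swap
      · exact .inr (.inr rfl)

/-- The end $v_1$ has a unique neighbour $x$ in $H$ and $v_2$ a unique neighbour $y$, so all the
neighbour sets are singletons once the ear from $x$ to $y$ has been analysed. -/
theorem K4Subdivision.IsOdd.directConnection {H : K4Subdivision G} {l : ℕ} (hl : 4 ≤ l)
    (hG : InFamily l G) (hH : H.IsOdd)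
    (hmin : ∀ H' : K4Subdivision G, H'.IsOdd → H.P₂.length ≤ H'.P₂.length)
    {v₁ v₂ : V} {P : G.Walk v₁ v₂}
    (hP : IsDirectConnection G (H.verts \ innerVerts H.P₂) (innerVerts H.P₂) P) :
    nbrs G H.verts v₁ = nbrs G (H.verts \ innerVerts H.P₂) v₁ ∧
      (nbrs G (H.verts \ innerVerts H.P₂) v₁ = {H.u₃} ∨
        nbrs G (H.verts \ innerVerts H.P₂) v₁ = {H.u₄}) ∧
      nbrs G H.verts v₂ = nbrs G (innerVerts H.P₂) v₂ ∧
      nbrs G (innerVerts H.P₂) v₂ =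
        nbrsOfSet G (innerVerts H.P₂) (nbrs G H.verts v₁) := by
  obtain ⟨x, ⟨hxv, hxi⟩, hx⟩ := (hP.left_iff v₁ P.start_mem_support).2 rfl
  obtain ⟨y, hyi, hy⟩ := (hP.right_iff v₂ P.end_mem_support).2 rfl
  have hyv := K4Subdivision.innerVerts_subset_verts hyi
  have hxy : x ≠ y := fun h => hxi (h ▸ hyi)
  have hout : ∀ z ∈ P.support, z ∉ H.verts := by
    intro z hz hzv
    by_cases h : z ∈ innerVerts H.P₂
    exacts [hP.notMem_right z hz h, hP.notMem_left z hz ⟨hzv, h⟩]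
  have u₁ : ∀ s ∈ H.verts, G.Adj v₁ s → s = x := fun s hs h =>
    hH.eq_of_adj hl hG (hout _ P.start_mem_support) hs hxv h hx
  have u₂ : ∀ s ∈ H.verts, G.Adj v₂ s → s = y := fun s hs h =>
    hH.eq_of_adj hl hG (hout _ P.end_mem_support) hs hyv h hy
  obtain ⟨R, hR⟩ := exists_isEar hP.isPath hP.chordless hout hxv hyv hxy hx hy (by
    intro z hz s hs hzs
    by_cases h : s ∈ innerVerts H.P₂
    · obtain rfl := (hP.right_iff z hz).1 ⟨s, h, hzs⟩
      exact .inr ⟨rfl, u₂ s hs hzs⟩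
    · obtain rfl := (hP.left_iff z hz).1 ⟨s, ⟨hs, h⟩, hzs⟩
      exact .inl ⟨rfl, u₁ s hs hzs⟩)
  obtain ⟨hx34, hadj⟩ := hH.ear hl hG hmin hR hxi hyi
  have n₁ : nbrs G H.verts v₁ = {x} := by
    ext s
    exact ⟨fun h => u₁ s h.1 h.2, fun h => h ▸ ⟨hxv, hx⟩⟩
  have n₁' : nbrs G (H.verts \ innerVerts H.P₂) v₁ = {x} := by
    ext s
    exact ⟨fun h => u₁ s h.1.1 h.2, fun h => h ▸ ⟨⟨hxv, hxi⟩, hx⟩⟩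
  have n₂ : nbrs G H.verts v₂ = {y} := by
    ext s
    exact ⟨fun h => u₂ s h.1 h.2, fun h => h ▸ ⟨hyv, hy⟩⟩
  have n₂' : nbrs G (innerVerts H.P₂) v₂ = {y} := by
    ext s
    exact ⟨fun h => u₂ s (K4Subdivision.innerVerts_subset_verts h.1) h.2, fun h => h ▸ ⟨hyi, hy⟩⟩
  have n₃ : nbrsOfSet G (innerVerts H.P₂) {x} = {y} := by
    ext s
    constructor
    · rintro ⟨hs, -, _, rfl, h⟩
      exact hH.eq_of_adj_end hl hG hx34 hyi hs hadj h
    · rintro rfl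
      exact ⟨hyi, fun h => hxy (Set.mem_singleton_iff.1 h).symm, x, rfl, hadj⟩
  rw [n₁, n₁', n₂, n₂', n₃]
  exact ⟨rfl, hx34.imp (congrArg _) (congrArg _), rfl, rfl⟩

end OddK4

theorem lemma3p1 {V : Type*} [Finite V] (l : ℕ) (hl : 4 ≤ l) (G : SimpleGraph V)
    (hG : OddK4.InFamily l G) (hcrit : OddK4.IsVertexCritical 4 G) :
    (¬ ∃ H : OddK4.K4Subdivision G, H.IsOdd) ∨
    ∃ H : OddK4.K4Subdivision G, H.IsOdd ∧
      ∀ (v₁ v₂ : V) (P : G.Walk v₁ v₂),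
        OddK4.IsMinimalDirectConnection G
          (H.verts \ OddK4.innerVerts H.P₂) (OddK4.innerVerts H.P₂) P →
        OddK4.nbrs G H.verts v₁ = OddK4.nbrs G (H.verts \ OddK4.innerVerts H.P₂) v₁ ∧
        (OddK4.nbrs G (H.verts \ OddK4.innerVerts H.P₂) v₁ = {H.u₃} ∨
          OddK4.nbrs G (H.verts \ OddK4.innerVerts H.P₂) v₁ = {H.u₄}) ∧
        OddK4.nbrs G H.verts v₂ = OddK4.nbrs G (OddK4.innerVerts H.P₂) v₂ ∧
        OddK4.nbrs G (OddK4.innerVerts H.P₂) v₂ =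
          OddK4.nbrsOfSet G (OddK4.innerVerts H.P₂) (OddK4.nbrs G H.verts v₁) := by
  classical
  by_cases hex : ∃ H : OddK4.K4Subdivision G, H.IsOdd
  · right
    have hex' : ∃ n, ∃ H : OddK4.K4Subdivision G, H.IsOdd ∧ H.P₂.length = n :=
      hex.imp' (fun H => H.P₂.length) fun H hH => ⟨H, hH, rfl⟩
    -- `Nat.find` selects the least length of $P_2$ over all odd subdivisions.
    obtain ⟨H, hH, hlen⟩ := Nat.find_spec hex'
    exact ⟨H, hH, fun v₁ v₂ P hP => hH.directConnection hl hG
      (fun H' hH' => hlen.trans_le (Nat.find_min' hex' ⟨H', hH', rfl⟩)) hP.isDirectConnection⟩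
  · exact .inl hex
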